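/- Let $\mathbb T=\{\lambda\in\mathbb C:|\lambda|=1\}$, and for a Borel probability measure $\mu$ on $\mathbb T$ put $\hat\mu(n)=\int_{\mathbb T}\lambda^n\,d\mu(\lambda)$, $n\in\mathbb Z$; $\mu$ is called continuous if $\mu(\{\lambda\})=0$ for every $\lambda\in\mathbb T$. A set $Q\subset\mathbb Z$ is generating if the smallest subgroup of $\mathbb Z$ containing $Q$ is $\mathbb Z$. It is a Kazhdan set if there is $\varepsilon>0$ such that every unitary operator $U$ on a complex separable Hilbert space $H$ for which some $x\in H$ with $\|x\|=1$ satisfies $\sup_{n\in Q}\|U^nx-x\|<\varepsilon$ has a non-zero fixed vector. The modified Kazhdan constant of $Q$ is $$\tilde\kappa(Q)=\inf_V\inf_{\|x\|=1}\sup_{n\in Q}\|V^nx-x\|,$$ where $V$ runs over all unitary operators without eigenvalues on complex separable Hilbert spaces. Let $Q$ be a generating subset of $\mathbb Z$. The following assertions are equivalent: (α) $Q$ is a Kazhdan set and $\tilde\kappa(Q)=\sqrt2$; (β) every continuous Borel probability measure $\mu$ on $\mathbb T$ satisfies $\inf_{n\in Q}|\hat\mu(n)|=0$; (γ) every continuous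 Borel probability measure $\mu$ on $\mathbb T$ satisfies $\liminf_{|n|\to+\infty,\ n\in Q}|\hat\mu(n)|=0$ (where the lower limit is $+\infty$ if $Q$ is finite); (δ) (the property required in Lyons' Conjecture (C4)) for every continuous Borel probability measure $\mu$ on $\mathbb T$ there is a sequence $(n_k)_{k\ge1}$ of pairwise distinct elements of $Q$ with $\hat\mu(n_k)\to0$ as $k\to+\infty$. -/

import Mathlib

open MeasureTheory Filter Topology
open scoped ENNReal

noncomputable section

/-- The Borel `σ`-algebra on the unit circle. -/
instance Circle.instMeasurableSpaceBorel : MeasurableSpace Circle := borel Circle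

instance Circle.instBorelSpaceBorel : BorelSpace Circle := ⟨rfl⟩

namespace KazhdanZ

/-- The Fourier coefficient `μ̂(n) = ∫ λ ^ n dμ(λ)` of a measure on the unit circle. -/
def fourierCoefficient (μ : Measure Circle) (n : ℤ) : ℂ :=
  ∫ z : Circle, (z : ℂ) ^ n ∂μ

/-- A measure on the circle is continuous (atomless) if every point has measure zero. -/
def IsContinuousMeasure (μ : Measure Circle) : Prop :=
  ∀ z : Circle, μ {z} = 0

/-- `Q` generates the group `ℤ`. -/
def IsGenerating (Q : Set ℤ) : Prop :=
  AddSubgroup.closure Q = ⊤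

section Operators

variable {H : Type*} [NormedAddCommGroup H] [InnerProductSpace ℂ H] [CompleteSpace H]

/-- The displacement `sup_{q ∈ Q} ‖U ^ q x - x‖` of a vector `x` under the powers of a unitary
operator; the family is bounded by `2 ‖x‖`, so this is an honest real supremum. -/
def displacement (Q : Set ℤ) (U : unitary (H →L[ℂ] H)) (x : H) : ℝ :=
  ⨆ q : Q, ‖((U ^ (q : ℤ) : unitary (H →L[ℂ] H)) : H →L[ℂ] H) x - x‖

/-- The unitary operator `U` has a non-zero fixed vector. -/
def HasFixedVector (U : unitary (H →L[ℂ] H)) : Prop :=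
  ∃ y : H, y ≠ 0 ∧ (U : H →L[ℂ] H) y = y

/-- The unitary operator `V` has at least one eigenvalue. -/
def HasSomeEigenvalue (V : unitary (H →L[ℂ] H)) : Prop :=
  ∃ c : ℂ, ∃ y : H, y ≠ 0 ∧ (V : H →L[ℂ] H) y = c • y

end Operators

/-- `(Q, ε)` is a Kazhdan pair: every unitary operator on a complex separable Hilbert space that
displaces some unit vector by less than `ε` along `Q` has a non-zero fixed vector.
(Every separable Hilbert space is isometrically isomorphic to one in `Type`.) -/
def IsKazhdanPair (Q : Set ℤ) (ε : ℝ) : Prop :=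
  ∀ (H : Type) [NormedAddCommGroup H] [InnerProductSpace ℂ H] [CompleteSpace H]
    [TopologicalSpace.SeparableSpace H] (U : unitary (H →L[ℂ] H)),
    (∃ x : H, ‖x‖ = 1 ∧ displacement Q U x < ε) → HasFixedVector U

/-- `Q` is a Kazhdan subset of `ℤ`. -/
def IsKazhdanSet (Q : Set ℤ) : Prop :=
  ∃ ε : ℝ, 0 < ε ∧ IsKazhdanPair Q ε

/-- The numbers `sup_{q ∈ Q} ‖V ^ q x - x‖`, where `V` runs over the unitary operators without
eigenvalues on complex separable Hilbert spaces and `x` over the unit vectors. -/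
def modifiedDisplacements (Q : Set ℤ) : Set ℝ :=
  {r | ∃ (H : Type) (_ : NormedAddCommGroup H) (_ : InnerProductSpace ℂ H) (_ : CompleteSpace H)
    (_ : TopologicalSpace.SeparableSpace H) (V : unitary (H →L[ℂ] H)) (x : H),
    ¬ HasSomeEigenvalue V ∧ ‖x‖ = 1 ∧ r = displacement Q V x}

/-- The modified Kazhdan constant of `Q`. The set of reals is bounded below by `0`, and non-empty
because the bilateral shift on `ℓ²(ℤ)` has no eigenvalue. -/
def modifiedKazhdanConstant (Q : Set ℤ) : ℝ :=
  sInf (modifiedDisplacements Q)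

/-- The filter of neighbourhoods of `|n| → +∞` with `n ∈ Q`; it is trivial when `Q` is finite. -/
def absAtTopWithin (Q : Set ℤ) : Filter ℤ :=
  comap (fun n : ℤ => |n|) atTop ⊓ 𝓟 Q

end KazhdanZ

end

/-! A unit vector `x` and a unitary `U` correspond to a probability measure `μ` on the circle with
`μ̂(n) = ⟨x, Uⁿx⟩`, so that `‖Uⁿx - x‖² = 2 - 2 Re μ̂(n)`. Atoms of `μ` give eigenvectors of `U`;
conversely multiplication by `z` on `L²(μ)`, for continuous `μ`, has no eigenvalue. Hence the
modified constant measures how far above `0` the numbers `Re μ̂` can stay on `Q` for continuous `μ`.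
Since `|μ̂|²` is again the transform of a continuous measure, real parts may be replaced by moduli,
so (β) amounts to `κ̃(Q) = √2`; Haar measure shows that `√2` is never exceeded.

The hard point is that (β) makes `Q` a Kazhdan set. Otherwise there are measures `σ_k` with no mass
at `1` and `σ̂_k → 1` uniformly on `Q`, as fast as desired. The infinite convolution of `(δ₁ +
σ_k)/2` then has coefficients near `1` on `Q`. Because `Q` generates `ℤ`, the `σ_k` concentrate at
`1`; each factor splits every atom into two nearby halves, so the product is continuous
(`isContinuousMeasure_of_mconv`), contradicting (β).

For (β) ⇒ (γ), averaging `|μ̂|²` with `|τ̂|²`, where `τ` is continuous with no zero coefficient at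
low frequencies, forces the small coefficients of `μ` out to infinity. -/

namespace KazhdanZ

/-! ### Fourier coefficients, midpoints and convolutions of measures -/

theorem continuous_coe_zpow (n : ℤ) : Continuous fun z : Circle => (z : ℂ) ^ n := by
  have h : (fun z : Circle => (z : ℂ) ^ n) = fun z : Circle => ((z ^ n : Circle) : ℂ) := by
    ext z; simp
  rw [h]
  exact Continuous.comp (g := fun z : Circle => (z : ℂ)) (by fun_prop) (continuous_zpow n)

theorem norm_coe_zpow (z : Circle) (n : ℤ) : ‖(z : ℂ) ^ n‖ = 1 := by
  rw [norm_zpow, Circle.norm_coe, one_zpow]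

theorem integrable_of_continuous {E : Type*} [NormedAddCommGroup E] [SecondCountableTopology E]
    {μ : Measure Circle} [IsFiniteMeasure μ]
    {f : Circle → E} (hf : Continuous f) : Integrable f μ :=
  hf.integrable_of_hasCompactSupport (HasCompactSupport.of_compactSpace f)

theorem integrable_coe_zpow (μ : Measure Circle) [IsFiniteMeasure μ] (n : ℤ) :
    Integrable (fun z : Circle => (z : ℂ) ^ n) μ :=
  integrable_of_continuous (continuous_coe_zpow n)

theorem fourierCoefficient_zero (μ : Measure Circle) [IsProbabilityMeasure μ] :
    fourierCoefficient μ 0 = 1 := by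
  simp [fourierCoefficient]

theorem fourierCoefficient_dirac_one (n : ℤ) :
    fourierCoefficient (Measure.dirac 1) n = 1 := by
  simp [fourierCoefficient]

theorem norm_fourierCoefficient_le (μ : Measure Circle) [IsProbabilityMeasure μ] (n : ℤ) :
    ‖fourierCoefficient μ n‖ ≤ 1 := by
  refine (norm_integral_le_integral_norm _).trans ?_
  simp [norm_coe_zpow, -norm_zpow]

theorem fourierCoefficient_mconv (μ ν : Measure Circle) [IsProbabilityMeasure μ]
    [IsProbabilityMeasure ν] (n : ℤ) :
    fourierCoefficient (μ ∗ₘ ν) n = fourierCoefficient μ n * fourierCoefficient ν n := by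
  unfold fourierCoefficient
  rw [integral_mconv (integrable_coe_zpow _ n)]
  simp [mul_zpow, integral_const_mul, integral_mul_const]

theorem fourierCoefficient_map_inv (μ : Measure Circle) (n : ℤ) :
    fourierCoefficient (μ.map (·⁻¹)) n = starRingEnd ℂ (fourierCoefficient μ n) := by
  unfold fourierCoefficient
  rw [integral_map (by fun_prop) (continuous_coe_zpow n).aestronglyMeasurable, ← integral_conj]
  simp only [Circle.coe_inv_eq_conj, map_zpow₀]

/-- The midpoint of two measures. -/
noncomputable def midMeasure (μ ν : Measure Circle) : Measure Circle :=
  (2⁻¹ : ℝ≥0∞) • (μ + ν)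

instance (μ ν : Measure Circle) [IsProbabilityMeasure μ] [IsProbabilityMeasure ν] :
    IsProbabilityMeasure (midMeasure μ ν) := by
  refine ⟨?_⟩
  simp only [midMeasure, Measure.smul_apply, Measure.add_apply, measure_univ, smul_eq_mul]
  rw [one_add_one_eq_two]
  exact ENNReal.inv_mul_cancel (by simp) (by simp)

theorem fourierCoefficient_midMeasure (μ ν : Measure Circle) [IsProbabilityMeasure μ]
    [IsProbabilityMeasure ν] (n : ℤ) :
    fourierCoefficient (midMeasure μ ν) n
      = (fourierCoefficient μ n + fourierCoefficient ν n) / 2 := by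
  unfold fourierCoefficient midMeasure
  rw [integral_smul_measure, integral_add_measure (integrable_coe_zpow _ n)
    (integrable_coe_zpow _ n)]
  simp [div_eq_inv_mul, mul_add]

theorem IsContinuousMeasure.midMeasure {μ ν : Measure Circle} (hμ : IsContinuousMeasure μ)
    (hν : IsContinuousMeasure ν) : IsContinuousMeasure (midMeasure μ ν) := by
  intro z
  simp [KazhdanZ.midMeasure, hμ z, hν z]

theorem mconv_apply (μ ν : Measure Circle) [IsProbabilityMeasure ν] {s : Set Circle}
    (hs : MeasurableSet s) : (μ ∗ₘ ν) s = ∫⁻ z, ν {w | z * w ∈ s} ∂μ := by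
  rw [Measure.mconv, Measure.map_apply (by fun_prop) hs,
    Measure.prod_apply (measurable_mul hs)]
  rfl

/-- The mass of a point is the `μ`-average of `ν`-masses of its translates, so one continuous factor
suffices. -/
theorem IsContinuousMeasure.mconv_right (μ : Measure Circle) {ν : Measure Circle}
    [IsProbabilityMeasure ν] (hν : IsContinuousMeasure ν) : IsContinuousMeasure (μ ∗ₘ ν) := by
  intro x
  rw [mconv_apply _ _ (measurableSet_singleton x)]
  have h : ∀ z : Circle, {w | z * w ∈ ({x} : Set Circle)} = {z⁻¹ * x} := by
    intro z; ext w; simp [eq_inv_mul_iff_mul_eq]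
  simp only [h, hν _, lintegral_zero]

/-- The measure whose coefficients are the squared moduli of those of `μ`. -/
noncomputable def normSqMeasure (μ : Measure Circle) : Measure Circle :=
  (μ.map (·⁻¹)) ∗ₘ μ

instance isProbabilityMeasure_map_inv (μ : Measure Circle) [IsProbabilityMeasure μ] :
    IsProbabilityMeasure (μ.map (·⁻¹)) :=
  Measure.isProbabilityMeasure_map (by fun_prop)

instance (μ : Measure Circle) [IsProbabilityMeasure μ] :
    IsProbabilityMeasure (normSqMeasure μ) := by
  unfold normSqMeasure; infer_instance

theorem fourierCoefficient_normSqMeasure (μ : Measure Circle) [IsProbabilityMeasure μ] (n : ℤ) :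
    fourierCoefficient (normSqMeasure μ) n = ((‖fourierCoefficient μ n‖ ^ 2 : ℝ) : ℂ) := by
  rw [normSqMeasure, fourierCoefficient_mconv, fourierCoefficient_map_inv, mul_comm,
    Complex.mul_conj, Complex.normSq_eq_norm_sq]

theorem IsContinuousMeasure.normSqMeasure {μ : Measure Circle} [IsProbabilityMeasure μ]
    (hμ : IsContinuousMeasure μ) : IsContinuousMeasure (normSqMeasure μ) :=
  hμ.mconv_right _

/-! ### Uniqueness and compactness for Fourier transforms -/

/-- A probability measure on the circle is determined by its Fourier coefficients. -/
theorem ext_of_fourierCoefficient {μ ν : Measure Circle} [IsProbabilityMeasure μ]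
    [IsProbabilityMeasure ν] (h : ∀ n, fourierCoefficient μ n = fourierCoefficient ν n) :
    μ = ν := by
  let χ : ℤ → BoundedContinuousFunction Circle ℂ := fun n =>
    BoundedContinuousFunction.mkOfCompact ⟨fun z => (z : ℂ) ^ n, continuous_coe_zpow n⟩
  have hχ : ∀ n (z : Circle), χ n z = (z : ℂ) ^ n := fun _ _ => rfl
  have hadd : ∀ m n, χ m * χ n = χ (m + n) := by
    intro m n; ext z; simp [hχ, zpow_add₀]
  have hstar : ∀ n, star (χ n) = χ (-n) := by
    intro n; ext z
    simp only [BoundedContinuousFunction.star_apply, hχ, zpow_neg, Complex.star_def, map_zpow₀,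
      ← Circle.coe_inv_eq_conj, Circle.coe_inv, inv_zpow]
  have hone : χ 0 = 1 := by ext z; simp [hχ]
  -- The trigonometric polynomials: a star subalgebra which separates points through `χ 1`.
  let A : StarSubalgebra ℂ (BoundedContinuousFunction Circle ℂ) :=
    { Submodule.span ℂ (Set.range χ) with
      mul_mem' := by
        intro a b ha hb
        have := Submodule.mul_mem_mul ha hb
        rw [Submodule.span_mul_span] at this
        refine Submodule.span_mono ?_ this
        rintro _ ⟨_, ⟨m, rfl⟩, _, ⟨n, rfl⟩, rfl⟩
        exact ⟨m + n, (hadd m n).symm⟩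
      one_mem' := Submodule.subset_span ⟨0, hone⟩
      algebraMap_mem' := by
        intro c
        rw [Algebra.algebraMap_eq_smul_one]
        exact Submodule.smul_mem _ _ (Submodule.subset_span ⟨0, hone⟩)
      star_mem' := by
        intro a ha
        change star a ∈ Submodule.span ℂ (Set.range χ)
        change a ∈ Submodule.span ℂ (Set.range χ) at ha
        induction ha using Submodule.span_induction with
        | mem x hx =>
          obtain ⟨n, rfl⟩ := hx
          rw [hstar]
          exact Submodule.subset_span ⟨-n, rfl⟩
        | zero => simp
        | add x y _ _ hx hy => rw [star_add]; exact Submodule.add_mem _ hx hy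
        | smul c x _ hx => rw [star_smul]; exact Submodule.smul_mem _ _ hx }
  refine ext_of_forall_mem_subalgebra_integral_eq_of_pseudoEMetric_complete_countable (A := A)
    ?_ ?_
  · intro x y hxy
    refine ⟨χ 1, ⟨(χ 1).toContinuousMap, ⟨χ 1, Submodule.subset_span ⟨1, rfl⟩, rfl⟩, rfl⟩, ?_⟩
    simpa [hχ, Circle.ext_iff] using hxy
  · intro g hg
    change g ∈ Submodule.span ℂ (Set.range χ) at hg
    induction hg using Submodule.span_induction with
    | mem x hx => obtain ⟨n, rfl⟩ := hx; exact h n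
    | zero => simp
    | add x y _ _ hx hy =>
      simp only [BoundedContinuousFunction.add_apply]
      rw [integral_add (x.integrable _) (y.integrable _),
        integral_add (x.integrable _) (y.integrable _), hx, hy]
    | smul c x _ hx =>
      simp only [BoundedContinuousFunction.smul_apply]
      rw [integral_smul, integral_smul, hx]

/-- The Fourier transforms of the probability measures on the circle, as a multiplicative
submonoid of `ℤ → ℂ`. -/
noncomputable def fourierTransforms : Submonoid (ℤ → ℂ) where
  carrier := {φ | ∃ μ : Measure Circle, IsProbabilityMeasure μ ∧ fourierCoefficient μ = φ}
  mul_mem' := by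
    rintro _ _ ⟨μ, _, rfl⟩ ⟨ν, _, rfl⟩
    exact ⟨μ ∗ₘ ν, inferInstance, funext fun n => fourierCoefficient_mconv μ ν n⟩
  one_mem' := ⟨Measure.dirac 1, inferInstance, funext fourierCoefficient_dirac_one⟩

theorem mem_fourierTransforms {φ : ℤ → ℂ} : φ ∈ fourierTransforms ↔
    ∃ μ : Measure Circle, IsProbabilityMeasure μ ∧ fourierCoefficient μ = φ := Iff.rfl

/-- Continuous image of the weakly compact space of probability measures. This supplies the limits
both of infinite convolutions and of Fejér means. -/
theorem isCompact_fourierTransforms : IsCompact (fourierTransforms : Set (ℤ → ℂ)) := by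
  have hc : Continuous fun (μ : ProbabilityMeasure Circle) (n : ℤ) =>
      fourierCoefficient (μ : Measure Circle) n := by
    refine continuous_pi fun n => ?_
    have hre : Continuous fun z : Circle => ((z : ℂ) ^ n).re :=
      Complex.continuous_re.comp (continuous_coe_zpow n)
    have him : Continuous fun z : Circle => ((z : ℂ) ^ n).im :=
      Complex.continuous_im.comp (continuous_coe_zpow n)
    have key : ∀ f : Circle → ℝ, Continuous f →
        Continuous fun μ : ProbabilityMeasure Circle => ∫ z, f z ∂(μ : Measure Circle) := by
      intro f hf
      rw [continuous_iff_continuousAt]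
      intro μ
      exact (ProbabilityMeasure.tendsto_iff_forall_integral_tendsto.mp tendsto_id)
        (BoundedContinuousFunction.mkOfCompact ⟨f, hf⟩)
    have heq : ∀ μ : ProbabilityMeasure Circle, fourierCoefficient (μ : Measure Circle) n =
        ((∫ z : Circle, ((z : ℂ) ^ n).re ∂(μ : Measure Circle) : ℝ) : ℂ) +
        ((∫ z : Circle, ((z : ℂ) ^ n).im ∂(μ : Measure Circle) : ℝ) : ℂ) * Complex.I := by
      intro μ
      exact (integral_re_add_im (𝕜 := ℂ) (integrable_coe_zpow _ n)).symm
    simp_rw [heq]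
    have h1 := key _ hre
    have h2 := key _ him
    fun_prop
  have h := isCompact_range hc
  convert h using 1
  ext φ
  simp only [SetLike.mem_coe, mem_fourierTransforms, Set.mem_range]
  constructor
  · rintro ⟨μ, hμ, rfl⟩
    exact ⟨⟨μ, hμ⟩, rfl⟩
  · rintro ⟨μ, rfl⟩
    exact ⟨μ, μ.2, rfl⟩

/-! ### Splitting of atoms under convolution -/

theorem dist_eq_norm_coe_sub (z w : Circle) : dist z w = ‖(z : ℂ) - w‖ := by
  rw [← dist_eq_norm]; rfl

theorem dist_mul_self (z x : Circle) : dist (z * x) x = dist z 1 := by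
  simp only [dist_eq_norm_coe_sub, Circle.coe_mul, Circle.coe_one]
  rw [show (z : ℂ) * x - x = (z - 1) * x by ring, norm_mul, Circle.norm_coe, mul_one]

/-- The constant `ρ s` stays under the integral so that point and ball can be compared for each `z`
separately. -/
theorem two_mul_midMeasure_dirac_mconv_apply (σ ρ : Measure Circle) [IsProbabilityMeasure σ]
    [IsProbabilityMeasure ρ] {s : Set Circle} (hs : MeasurableSet s) :
    2 * (midMeasure (Measure.dirac 1) σ ∗ₘ ρ) s
      = ∫⁻ z, (ρ s + ρ {w | z * w ∈ s}) ∂σ := by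
  rw [mconv_apply _ _ hs, midMeasure, lintegral_smul_measure, lintegral_add_measure,
    lintegral_dirac, smul_eq_mul, ← mul_assoc, ENNReal.mul_inv_cancel (by simp) (by simp),
    one_mul, lintegral_add_left measurable_const]
  simp

/-- Convolving with `(δ₁ + σ) / 2`, where `σ` has no mass at `1` but is concentrated near `1`,
roughly halves every atom relative to the mass of its neighbourhood. -/
theorem two_mul_measure_singleton_le (σ ρ : Measure Circle) [IsProbabilityMeasure σ]
    [IsProbabilityMeasure ρ] (hσ : σ {1} = 0) (x : Circle) (r : ℝ) :
    2 * (2 * (midMeasure (Measure.dirac 1) σ ∗ₘ ρ) {x})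
      ≤ 2 * (midMeasure (Measure.dirac 1) σ ∗ₘ ρ) (Metric.ball x r)
        + 4 * σ (Metric.ball 1 r)ᶜ := by
  have hball : MeasurableSet (Metric.ball (1 : Circle) r)ᶜ := measurableSet_ball.compl
  rw [two_mul_midMeasure_dirac_mconv_apply _ _ (measurableSet_singleton x),
    two_mul_midMeasure_dirac_mconv_apply _ _ measurableSet_ball,
    ← lintegral_const_mul' _ _ (by simp), ← lintegral_indicator_const hball,
    ← lintegral_add_right _ (measurable_const.indicator hball)]
  refine lintegral_mono_ae ?_
  have hae : ∀ᵐ z ∂σ, z ≠ 1 := by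
    rw [ae_iff]; simpa using hσ
  filter_upwards [hae] with z hz
  have hpre : {w | z * w ∈ ({x} : Set Circle)} = {z⁻¹ * x} := by
    ext w; simp [eq_inv_mul_iff_mul_eq]
  rw [hpre]
  -- For `z ≠ 1` near `1`, the points `x` and `z⁻¹x` are distinct, and both lie in the ball and in
  -- its translate by `z⁻¹`. For `z` far from `1` the trivial bound `4` is paid for by the
  -- indicator.
  by_cases hzr : z ∈ Metric.ball (1 : Circle) r
  · rw [Set.indicator_of_notMem (by simpa using hzr), add_zero]
    have hne : x ≠ z⁻¹ * x := by simpa using hz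
    have hr : 0 < r := Metric.pos_of_mem_ball hzr
    have hsum : ρ {x} + ρ {z⁻¹ * x} = ρ {x, z⁻¹ * x} := by
      rw [Set.insert_eq, measure_union (by simpa using hne) (measurableSet_singleton _)]
    rw [hsum, two_mul]
    rw [Metric.mem_ball] at hzr
    have hzi : dist (z⁻¹ * x) x < r := by
      have h := dist_mul_self z (z⁻¹ * x)
      rw [mul_inv_cancel_left] at h
      rwa [dist_comm, h]
    refine add_le_add (measure_mono ?_) (measure_mono ?_)
    · rintro w (rfl | rfl)
      · exact Metric.mem_ball_self hr
      · exact hzi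
    · rintro w (rfl | rfl)
      · change dist (z * w) w < r
        rwa [dist_mul_self]
      · change dist (z * (z⁻¹ * x)) x < r
        simpa using hr
  · rw [Set.indicator_of_mem (by simpa using hzr)]
    refine le_trans ?_ le_add_self
    calc 2 * (ρ {x} + ρ {z⁻¹ * x}) ≤ 2 * (1 + 1) := by gcongr <;> exact prob_le_one
      _ = 4 := by norm_num

/-- Letting `k → ∞` and then `r → 0` in `two_mul_measure_singleton_le` leaves `4 μ{x} ≤ 2 μ{x}`,
with finite masses. -/
theorem isContinuousMeasure_of_mconv {μ : Measure Circle} [IsProbabilityMeasure μ]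
    {σ ρ : ℕ → Measure Circle} [∀ k, IsProbabilityMeasure (σ k)] [∀ k, IsProbabilityMeasure (ρ k)]
    (hμ : ∀ k, μ = midMeasure (Measure.dirac 1) (σ k) ∗ₘ ρ k) (hσ : ∀ k, σ k {1} = 0)
    (hlim : ∀ r : ℝ, 0 < r → Tendsto (fun k => σ k (Metric.ball 1 r)ᶜ) atTop (𝓝 0)) :
    IsContinuousMeasure μ := by
  intro x
  have h1 : ∀ r : ℝ, 0 < r → 2 * (2 * μ {x}) ≤ 2 * μ (Metric.ball x r) := by
    intro r hr
    have h : ∀ k, 2 * (2 * μ {x}) ≤ 2 * μ (Metric.ball x r) + 4 * σ k (Metric.ball 1 r)ᶜ := by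
      intro k
      have := two_mul_measure_singleton_le (σ k) (ρ k) (hσ k) x r
      rwa [← hμ k] at this
    have ht : Tendsto (fun k => 2 * μ (Metric.ball x r) + 4 * σ k (Metric.ball 1 r)ᶜ) atTop
        (𝓝 (2 * μ (Metric.ball x r) + 4 * 0)) :=
      (ENNReal.Tendsto.const_mul (hlim r hr) (Or.inr (by simp))).const_add _
    rw [mul_zero, add_zero] at ht
    exact ge_of_tendsto' ht h
  have h2 : Tendsto (fun r => μ (Metric.thickening r {x})) (𝓝[>] 0) (𝓝 (μ {x})) :=
    tendsto_measure_thickening_of_isClosed ⟨1, one_pos, measure_ne_top _ _⟩ isClosed_singleton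
  have h3 : 2 * (2 * μ {x}) ≤ 2 * μ {x} := by
    refine ge_of_tendsto (ENNReal.Tendsto.const_mul h2 (Or.inr (by simp))) ?_
    filter_upwards [self_mem_nhdsWithin] with r hr
    rw [Metric.thickening_singleton]
    exact h1 r hr
  have h4 : 2 * μ {x} ≤ μ {x} := by
    rwa [ENNReal.mul_le_mul_iff_right (by simp) (by simp)] at h3
  by_contra hne
  have h5 : 2 * μ {x} ≤ 1 * μ {x} := by rwa [one_mul]
  rw [ENNReal.mul_le_mul_iff_left hne (measure_ne_top _ _)] at h5
  norm_num at h5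

/-! ### Concentration at `1` from coefficients tending to `1` on a generating set -/

theorem normSq_sub_one (w : ℂ) (hw : ‖w‖ = 1) : ‖w - 1‖ ^ 2 = 2 - 2 * w.re := by
  have h1 : w.re * w.re + w.im * w.im = 1 := by
    rw [← Complex.normSq_apply, Complex.normSq_eq_norm_sq, hw, one_pow]
  rw [← Complex.normSq_eq_norm_sq, Complex.normSq_apply]
  simp
  linarith

theorem integral_norm_zpow_sub_one_sq (μ : Measure Circle) [IsProbabilityMeasure μ] (n : ℤ) :
    ∫ z : Circle, ‖(z : ℂ) ^ n - 1‖ ^ 2 ∂μ = 2 - 2 * (fourierCoefficient μ n).re := by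
  simp_rw [fun z : Circle => normSq_sub_one _ (norm_coe_zpow z n)]
  have hint : Integrable (fun z : Circle => ((z : ℂ) ^ n).re) μ := (integrable_coe_zpow μ n).re
  rw [integral_sub (integrable_const _) (hint.const_mul 2), integral_const_mul]
  have := integral_re (integrable_coe_zpow μ n)
  simp only [RCLike.re_to_complex] at this
  rw [this]
  simp [fourierCoefficient]

/-- The integers `n` with this property form a subgroup, and it contains `Q`. -/
theorem tendsto_integral_of_isGenerating {Q : Set ℤ} (hQ : IsGenerating Q)
    {σ : ℕ → Measure Circle} [∀ k, IsProbabilityMeasure (σ k)]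
    (h : ∀ q ∈ Q, Tendsto (fun k => fourierCoefficient (σ k) q) atTop (𝓝 1)) (n : ℤ) :
    Tendsto (fun k => ∫ z : Circle, ‖(z : ℂ) ^ n - 1‖ ^ 2 ∂σ k) atTop (𝓝 0) := by
  have hn : n ∈ AddSubgroup.closure Q := by
    rw [show AddSubgroup.closure Q = ⊤ from hQ]; trivial
  have hi : ∀ k (m : ℤ), Integrable (fun z : Circle => ‖(z : ℂ) ^ m - 1‖ ^ 2) (σ k) :=
    fun k m => integrable_of_continuous
      (((continuous_coe_zpow m).sub continuous_const).norm.pow 2)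
  induction hn using AddSubgroup.closure_induction with
  | mem q hq =>
    simp_rw [integral_norm_zpow_sub_one_sq]
    have := (Complex.continuous_re.tendsto _).comp (h q hq)
    have := (this.const_mul 2).const_sub 2
    simpa using this
  | zero => simp
  | add m n _ _ hm hn =>
    have hle : ∀ k, ∫ z : Circle, ‖(z : ℂ) ^ (m + n) - 1‖ ^ 2 ∂σ k ≤
        2 * ∫ z : Circle, ‖(z : ℂ) ^ m - 1‖ ^ 2 ∂σ k
          + 2 * ∫ z : Circle, ‖(z : ℂ) ^ n - 1‖ ^ 2 ∂σ k := by
      intro k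
      rw [← integral_const_mul, ← integral_const_mul,
        ← integral_add ((hi k m).const_mul 2) ((hi k n).const_mul 2)]
      refine integral_mono (hi k _) (((hi k m).const_mul 2).add ((hi k n).const_mul 2)) ?_
      intro z
      have h1 : ‖(z : ℂ) ^ (m + n) - 1‖ ≤ ‖(z : ℂ) ^ m - 1‖ + ‖(z : ℂ) ^ n - 1‖ := by
        have : (z : ℂ) ^ (m + n) - 1 = ((z : ℂ) ^ m - 1) * (z : ℂ) ^ n + ((z : ℂ) ^ n - 1) := by
          rw [zpow_add₀ z.coe_ne_zero]; ring
        rw [this]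
        refine (norm_add_le _ _).trans ?_
        rw [norm_mul, norm_coe_zpow, mul_one]
      simp only
      nlinarith [sq_nonneg (‖(z : ℂ) ^ m - 1‖ - ‖(z : ℂ) ^ n - 1‖),
        norm_nonneg ((z : ℂ) ^ (m + n) - 1)]
    refine squeeze_zero (fun k => integral_nonneg fun z => by positivity) hle ?_
    simpa using (hm.const_mul 2).add (hn.const_mul 2)
  | neg m _ hm =>
    have heq : ∀ z : Circle, ‖(z : ℂ) ^ (-m) - 1‖ = ‖(z : ℂ) ^ m - 1‖ := by
      intro z
      have : (z : ℂ) ^ (-m) - 1 = -((z : ℂ) ^ (-m) * ((z : ℂ) ^ m - 1)) := by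
        rw [mul_sub, ← zpow_add₀ z.coe_ne_zero]; simp
      rw [this, norm_neg, norm_mul, norm_coe_zpow, one_mul]
    simpa only [heq] using hm

/-- Markov's inequality for `‖z - 1‖²`, the case `n = 1` of `tendsto_integral_of_isGenerating`. -/
theorem tendsto_measure_compl_ball {Q : Set ℤ} (hQ : IsGenerating Q)
    {σ : ℕ → Measure Circle} [∀ k, IsProbabilityMeasure (σ k)]
    (h : ∀ q ∈ Q, Tendsto (fun k => fourierCoefficient (σ k) q) atTop (𝓝 1)) {r : ℝ}
    (hr : 0 < r) : Tendsto (fun k => σ k (Metric.ball 1 r)ᶜ) atTop (𝓝 0) := by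
  have ht := (tendsto_integral_of_isGenerating hQ h 1).const_mul (r ^ 2)⁻¹
  rw [mul_zero] at ht
  have hreal : Tendsto (fun k => (σ k).real (Metric.ball 1 r)ᶜ) atTop (𝓝 0) := by
    refine squeeze_zero (fun _ => measureReal_nonneg) (fun k => ?_) ht
    have hmk := mul_meas_ge_le_integral_of_nonneg (μ := σ k)
      (f := fun z : Circle => ‖(z : ℂ) ^ (1 : ℤ) - 1‖ ^ 2) (ae_of_all _ fun z => by positivity)
      (integrable_of_continuous
        (((continuous_coe_zpow 1).sub continuous_const).norm.pow 2)) (r ^ 2)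
    rw [le_inv_mul_iff₀ (by positivity)]
    refine le_trans ?_ hmk
    gcongr
    · finiteness
    intro z hz
    simp only [Set.mem_compl_iff, Metric.mem_ball, not_lt, dist_eq_norm_coe_sub,
      Circle.coe_one] at hz
    simp only [Set.mem_ofPred_eq, zpow_one]
    gcongr
  rw [← ENNReal.tendsto_toReal_iff (fun _ => measure_ne_top _ _) (by simp)]
  simpa [Measure.real] using hreal

/-! ### The infinite convolution product -/

theorem norm_prod_sub_one_le {f : ℕ → ℂ} {ε : ℕ → ℝ} (hf : ∀ k, ‖f k‖ ≤ 1)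
    (hε : ∀ k, ‖f k - 1‖ ≤ ε k) (N : ℕ) :
    ‖∏ k ∈ Finset.range N, f k - 1‖ ≤ ∑ k ∈ Finset.range N, ε k := by
  induction N with
  | zero => simp
  | succ N ih =>
    rw [Finset.prod_range_succ, Finset.sum_range_succ]
    calc ‖(∏ k ∈ Finset.range N, f k) * f N - 1‖
        = ‖(∏ k ∈ Finset.range N, f k - 1) * f N + (f N - 1)‖ := by congr 1; ring
      _ ≤ ‖∏ k ∈ Finset.range N, f k - 1‖ * ‖f N‖ + ‖f N - 1‖ := by
        refine (norm_add_le _ _).trans ?_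
        rw [norm_mul]
      _ ≤ _ := add_le_add ((mul_le_of_le_one_right (norm_nonneg _) (hf N)).trans ih) (hε N)

/-- If `Q` is generating and there are probability measures without mass at `1` whose coefficients
on `Q` are uniformly as close to `1` as we please, then there is a continuous one with coefficients
on `Q` bounded away from `0`: an infinite convolution product. -/
theorem exists_isContinuousMeasure_norm_sub_one_le {Q : Set ℤ} (hQ : IsGenerating Q)
    (h : ∀ ε : ℝ, 0 < ε → ∃ σ : Measure Circle, IsProbabilityMeasure σ ∧ σ {1} = 0 ∧
      ∀ q ∈ Q, ‖fourierCoefficient σ q - 1‖ ≤ ε) :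
    ∃ μ : Measure Circle, IsProbabilityMeasure μ ∧ IsContinuousMeasure μ ∧
      ∀ q ∈ Q, ‖fourierCoefficient μ q - 1‖ ≤ 1 / 2 := by
  -- Taking the midpoint with `δ₁` halves these errors once more, and `∑ 2⁻ᵏ / 4 = 1/2`.
  choose σ hσp hσ1 hσQ using fun k : ℕ => h ((1 / 2) ^ k / 2) (by positivity)
  let f : ℕ → ℤ → ℂ := fun k => fourierCoefficient (midMeasure (Measure.dirac 1) (σ k))
  have hf : ∀ k, f k ∈ fourierTransforms := fun k => ⟨_, inferInstance, rfl⟩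
  -- Limits along one ultrafilter are compatible with products, and convergence of the partial
  -- products need not be checked.
  let u : Ultrafilter ℕ := hyperfilter ℕ
  have hu : (u : Filter ℕ) ≤ atTop := by
    rw [← Nat.cofinite_eq_atTop]; exact hyperfilter_le_cofinite
  have hex : ∀ p : ℕ → ℤ → ℂ, (∀ N, p N ∈ fourierTransforms) →
      ∃ μ : Measure Circle, IsProbabilityMeasure μ ∧
        Tendsto p u (𝓝 (fourierCoefficient μ)) := by
    intro p hp
    obtain ⟨_, ⟨μ, hμ, rfl⟩, hlim⟩ := isCompact_fourierTransforms.ultrafilter_le_nhds (u.map p)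
      (le_principal_iff.mpr (Eventually.of_forall hp : ∀ᶠ N in u, p N ∈ fourierTransforms))
    exact ⟨μ, hμ, hlim⟩
  obtain ⟨μ, hμp, hμ⟩ := hex (fun N => ∏ k ∈ Finset.range N, f k)
    fun N => Submonoid.prod_mem _ fun k _ => hf k
  -- `ρ j` is the product with its `j`-th factor removed, so that every single factor can be split
  -- off from `μ`.
  choose ρ hρp hρ using fun j => hex (fun N => ∏ k ∈ (Finset.range N).erase j, f k)
    fun N => Submonoid.prod_mem _ fun k _ => hf k
  have hfac : ∀ k, μ = midMeasure (Measure.dirac 1) (σ k) ∗ₘ ρ k := by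
    intro k
    refine ext_of_fourierCoefficient fun n => ?_
    rw [fourierCoefficient_mconv]
    have h1 := tendsto_pi_nhds.mp hμ n
    have h2 := (tendsto_pi_nhds.mp (hρ k) n).const_mul (f k n)
    refine tendsto_nhds_unique h1 (h2.congr' ?_)
    filter_upwards [hu (eventually_gt_atTop k)] with N hN
    rw [← Finset.mul_prod_erase _ _ (Finset.mem_range.mpr hN), Pi.mul_apply]
  refine ⟨μ, hμp, isContinuousMeasure_of_mconv hfac hσ1 fun r hr =>
    tendsto_measure_compl_ball hQ (fun q hq => ?_) hr, fun q hq => ?_⟩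
  · rw [tendsto_iff_norm_sub_tendsto_zero]
    exact squeeze_zero (fun _ => norm_nonneg _) (fun k => hσQ k q hq)
      (by simpa using (tendsto_pow_atTop_nhds_zero_of_lt_one (r := (1 / 2 : ℝ))
        (by norm_num) (by norm_num)).div_const 2)
  · have h1 := tendsto_pi_nhds.mp hμ q
    refine le_of_tendsto (h1.sub_const 1).norm (Eventually.of_forall fun N => ?_)
    have hε : ∀ k, ‖f k q - 1‖ ≤ 1 / 4 * (1 / 2) ^ k := by
      intro k
      have : f k q - 1 = (fourierCoefficient (σ k) q - 1) / 2 := by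
        simp only [f, fourierCoefficient_midMeasure, fourierCoefficient_dirac_one]; ring
      rw [this, norm_div, RCLike.norm_ofNat]
      linarith [hσQ k q hq]
    have h2 := norm_prod_sub_one_le (f := fun k => f k q)
      (fun k => norm_fourierCoefficient_le _ _) hε N
    rw [← Finset.mul_sum] at h2
    rw [Finset.prod_apply]
    linarith [sum_geometric_two_le N]

/-! ### Haar measure and continuous measures without low-frequency zeros -/

/-- The normalized Haar measure of the circle. -/
noncomputable def circleHaar : Measure Circle :=
  Measure.haarMeasure ⊤

instance : circleHaar.IsHaarMeasure := by unfold circleHaar; infer_instance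

instance : IsProbabilityMeasure circleHaar :=
  ⟨by simpa [circleHaar] using Measure.haarMeasure_self (G := Circle) (K₀ := ⊤)⟩

theorem fourierCoefficient_circleHaar {n : ℤ} (hn : n ≠ 0) :
    fourierCoefficient circleHaar n = 0 := by
  -- Translation by an `n`-th root of `-1` changes the sign of the coefficient.
  let w : Circle := Circle.exp (Real.pi / n)
  have hw : (w : ℂ) ^ n = -1 := by
    rw [Circle.coe_exp, ← Complex.exp_int_mul, ← Complex.exp_pi_mul_I]
    congr 1
    have : (n : ℂ) ≠ 0 := by exact_mod_cast hn
    push_cast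
    field_simp
  have h : fourierCoefficient circleHaar n = -fourierCoefficient circleHaar n := by
    conv_lhs =>
      rw [fourierCoefficient, ← integral_mul_left_eq_self _ w]
    simp_rw [Circle.coe_mul, mul_zpow, hw, integral_const_mul]
    simp [fourierCoefficient]
  exact self_eq_neg.mp h

theorem integral_zpow_circleHaar (n : ℤ) :
    ∫ z : Circle, (z : ℂ) ^ n ∂circleHaar = if n = 0 then 1 else 0 := by
  split_ifs with h
  · rw [h]; exact fourierCoefficient_zero _
  · exact fourierCoefficient_circleHaar h

/-- Connected and nontrivial, the circle has no isolated point, hence Haar measure has no atom. -/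
instance : ConnectedSpace Circle :=
  Function.Surjective.connectedSpace (f := Circle.exp)
    (fun z => ⟨Complex.arg z, Circle.exp_arg z⟩) Circle.exp.continuous

instance : Nontrivial Circle :=
  ⟨1, -1, fun h => by
    have := congrArg (fun z : Circle => (z : ℂ).re) h
    norm_num at this⟩

theorem isContinuousMeasure_circleHaar : IsContinuousMeasure circleHaar :=
  fun z => measure_singleton z

/-- Haar measure conditioned on a small neighbourhood of `1`, where all `zⁿ` with `|n| ≤ N` are
close to `1`. -/
theorem exists_isContinuousMeasure_fourierCoefficient_ne_zero (N : ℕ) :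
    ∃ τ : Measure Circle, IsProbabilityMeasure τ ∧ IsContinuousMeasure τ ∧
      ∀ n : ℤ, |n| ≤ N → fourierCoefficient τ n ≠ 0 := by
  let V : Set Circle := ⋂ n ∈ Finset.Icc (-(N : ℤ)) N, {z : Circle | ‖(z : ℂ) ^ n - 1‖ < 1 / 2}
  have hVo : IsOpen V := isOpen_biInter_finset fun n _ =>
    isOpen_lt ((continuous_coe_zpow n).sub continuous_const).norm continuous_const
  have hV1 : (1 : Circle) ∈ V := by simp [V]
  have hV0 : circleHaar V ≠ 0 := (hVo.measure_pos _ ⟨1, hV1⟩).ne'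
  have hp : IsProbabilityMeasure (ProbabilityTheory.cond circleHaar V) :=
    ProbabilityTheory.cond_isProbabilityMeasure hV0
  refine ⟨ProbabilityTheory.cond circleHaar V, hp, fun z => ?_, fun n hn h0 => ?_⟩
  · exact ProbabilityTheory.cond_absolutelyContinuous (measure_singleton z)
  · have h1 : ‖∫ z : Circle, ((z : ℂ) ^ n - 1) ∂(ProbabilityTheory.cond circleHaar V)‖ ≤ 1 / 2 := by
      refine (norm_integral_le_of_norm_le_const (C := 1 / 2) ?_).trans (by simp)
      filter_upwards [ProbabilityTheory.ae_cond_mem hVo.measurableSet] with z hz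
      exact (Set.mem_iInter₂.mp hz n (Finset.mem_Icc.mpr (abs_le.mp hn))).le
    rw [integral_sub (integrable_coe_zpow _ n) (integrable_const _)] at h1
    rw [fourierCoefficient] at h0
    rw [h0] at h1
    norm_num at h1

/-! ### From continuous measures to unitaries without eigenvalues -/

section Multiplication

variable {μ : Measure Circle}

theorem memLp_coe_mul {g : Circle → Circle} (hg : Continuous g) (f : Lp ℂ 2 μ) :
    MemLp (fun z => (g z : ℂ) * f z) 2 μ := by
  refine (Lp.memLp f).of_le (AEStronglyMeasurable.mul ?_ (Lp.aestronglyMeasurable f))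
    (ae_of_all _ fun z => by simp [Circle.norm_coe])
  exact (Continuous.comp (g := fun z : Circle => (z : ℂ)) (by fun_prop) hg).aestronglyMeasurable

/-- Multiplication by a continuous function into the circle, as a linear map of `L²(μ)`. -/
noncomputable def mulLinear (g : Circle → Circle) (hg : Continuous g) :
    Lp ℂ 2 μ →ₗ[ℂ] Lp ℂ 2 μ where
  toFun f := (memLp_coe_mul hg f).toLp
  map_add' f₁ f₂ := by
    rw [← MemLp.toLp_add]
    refine MemLp.toLp_congr _ _ ?_
    filter_upwards [Lp.coeFn_add f₁ f₂] with z hz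
    rw [hz, Pi.add_apply, Pi.add_apply, mul_add]
  map_smul' c f := by
    rw [RingHom.id_apply, ← MemLp.toLp_const_smul]
    refine MemLp.toLp_congr _ _ ?_
    filter_upwards [Lp.coeFn_smul c f] with z hz
    simp only [hz, Pi.smul_apply, smul_eq_mul]
    ring

theorem coeFn_mulLinear {g : Circle → Circle} (hg : Continuous g) (f : Lp ℂ 2 μ) :
    (mulLinear g hg f : Circle → ℂ) =ᵐ[μ] fun z => (g z : ℂ) * f z :=
  MemLp.coeFn_toLp (memLp_coe_mul hg f)

theorem mulLinear_mulLinear {g h : Circle → Circle} (hg : Continuous g) (hh : Continuous h)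
    (hgh : ∀ z, g z * h z = 1) (f : Lp ℂ 2 μ) : mulLinear g hg (mulLinear h hh f) = f := by
  refine Lp.ext ?_
  filter_upwards [coeFn_mulLinear hg (mulLinear h hh f), coeFn_mulLinear hh f] with z h1 h2
  rw [h1, h2, ← mul_assoc, ← Circle.coe_mul, hgh, Circle.coe_one, one_mul]

variable (μ) in
/-- Multiplication by the independent variable on `L²(μ)`. -/
noncomputable def mulIsometryEquiv : Lp ℂ 2 μ ≃ₗᵢ[ℂ] Lp ℂ 2 μ where
  toLinearEquiv := LinearEquiv.ofLinearMap (mulLinear (fun z => z) continuous_id)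
    (mulLinear (fun z => z⁻¹) continuous_inv)
    (LinearMap.ext fun f => mulLinear_mulLinear continuous_id continuous_inv (fun z => mul_inv_cancel z) f)
    (LinearMap.ext fun f => mulLinear_mulLinear continuous_inv continuous_id (fun z => inv_mul_cancel z) f)
  norm_map' f := by
    change ‖mulLinear (fun z => z) continuous_id f‖ = ‖f‖
    rw [Lp.norm_def, Lp.norm_def]
    congr 1
    refine eLpNorm_congr_norm_ae ?_
    filter_upwards [coeFn_mulLinear (g := fun z => z) continuous_id f] with z hz
    rw [hz, norm_mul, Circle.norm_coe, one_mul]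

theorem coeFn_mulIsometryEquiv (f : Lp ℂ 2 μ) :
    (mulIsometryEquiv μ f : Circle → ℂ) =ᵐ[μ] fun z => (z : ℂ) * f z := by
  change (mulLinear (fun z => z) continuous_id f : Circle → ℂ) =ᵐ[μ] _
  exact coeFn_mulLinear _ f

theorem coeFn_mulIsometryEquiv_inv (f : Lp ℂ 2 μ) :
    ((mulIsometryEquiv μ)⁻¹ f : Circle → ℂ) =ᵐ[μ] fun z => (z : ℂ)⁻¹ * f z := by
  change (mulLinear (fun z => z⁻¹) continuous_inv f : Circle → ℂ) =ᵐ[μ] _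
  exact coeFn_mulLinear _ f

theorem coeFn_mulIsometryEquiv_zpow (n : ℤ) (f : Lp ℂ 2 μ) :
    ((mulIsometryEquiv μ ^ n) f : Circle → ℂ) =ᵐ[μ] fun z => (z : ℂ) ^ n * f z := by
  induction n using Int.induction_on generalizing f with
  | zero => simp
  | succ n ih =>
    rw [zpow_add_one]
    filter_upwards [ih (mulIsometryEquiv μ f), coeFn_mulIsometryEquiv f] with z h1 h2
    rw [zpow_add_one₀ z.coe_ne_zero, mul_assoc, ← h2, ← h1]
    rfl
  | pred n ih =>
    rw [zpow_sub_one]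
    filter_upwards [ih ((mulIsometryEquiv μ)⁻¹ f), coeFn_mulIsometryEquiv_inv f] with z h1 h2
    rw [zpow_sub_one₀ z.coe_ne_zero, mul_assoc, ← h2, ← h1]
    rfl

variable (μ) in
/-- Multiplication by the independent variable on `L²(μ)`, as a unitary operator. -/
noncomputable def mulUnitary : unitary (Lp ℂ 2 μ →L[ℂ] Lp ℂ 2 μ) :=
  Unitary.linearIsometryEquiv.symm (mulIsometryEquiv μ)

theorem coeFn_mulUnitary_zpow (n : ℤ) (f : Lp ℂ 2 μ) :
    (((mulUnitary μ ^ n : unitary (Lp ℂ 2 μ →L[ℂ] Lp ℂ 2 μ)) : Lp ℂ 2 μ →L[ℂ] Lp ℂ 2 μ) f :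
      Circle → ℂ) =ᵐ[μ] fun z => (z : ℂ) ^ n * f z := by
  rw [mulUnitary, ← map_zpow]
  exact coeFn_mulIsometryEquiv_zpow n f

/-- An eigenvector satisfies `(c - z) f(z) = 0`, so it lives on at most one point, a null set. -/
theorem not_hasSomeEigenvalue_mulUnitary (hμ : IsContinuousMeasure μ) :
    ¬ HasSomeEigenvalue (mulUnitary μ) := by
  rintro ⟨c, f, hf, hcf⟩
  refine hf (Lp.ext ?_)
  have hne : ∀ᵐ z : Circle ∂μ, (z : ℂ) ≠ c := by
    rw [ae_iff]
    by_cases hc : ∃ w : Circle, (w : ℂ) = c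
    · obtain ⟨w, rfl⟩ := hc
      refine measure_mono_null (fun z hz => ?_) (hμ w)
      simpa [Circle.ext_iff] using hz
    · push Not at hc
      simp [hc]
  have h1 := coeFn_mulUnitary_zpow (μ := μ) 1 f
  rw [zpow_one, hcf] at h1
  filter_upwards [h1, Lp.coeFn_smul c f, Lp.coeFn_zero ℂ 2 μ, hne] with z h1 h2 h3 h4
  rw [h2, zpow_one, Pi.smul_apply, smul_eq_mul] at h1
  rw [h3, Pi.zero_apply]
  have h5 : (c - z) * f z = 0 := by rw [sub_mul, h1, sub_self]
  exact (mul_eq_zero.mp h5).resolve_left (sub_ne_zero.mpr h4.symm)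

theorem norm_sq_eq_integral (f : Lp ℂ 2 μ) : ‖f‖ ^ 2 = ∫ z, ‖f z‖ ^ 2 ∂μ := by
  have h := inner_self_eq_norm_sq_to_K (𝕜 := ℂ) f
  rw [L2.inner_def] at h
  simp only [inner_self_eq_norm_sq_to_K] at h
  have h' : ((∫ z, ‖f z‖ ^ 2 ∂μ : ℝ) : ℂ) = ((‖f‖ ^ 2 : ℝ) : ℂ) := by
    have h2 := integral_ofReal (μ := μ) (𝕜 := ℂ) (f := fun z => ‖f z‖ ^ 2)
    simp only [RCLike.ofReal_pow, Complex.coe_algebraMap] at h2 h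
    rw [← h2, h, Complex.ofReal_pow]
  exact_mod_cast h'.symm

variable (μ) in
/-- The constant function `1` in `L²(μ)`. -/
noncomputable def oneLp [IsFiniteMeasure μ] : Lp ℂ 2 μ :=
  (memLp_const (1 : ℂ)).toLp

theorem coeFn_oneLp [IsFiniteMeasure μ] : (oneLp μ : Circle → ℂ) =ᵐ[μ] fun _ => 1 :=
  MemLp.coeFn_toLp _

theorem norm_oneLp [IsProbabilityMeasure μ] : ‖oneLp μ‖ = 1 := by
  have h : ‖oneLp μ‖ ^ 2 = 1 := by
    rw [norm_sq_eq_integral, integral_congr_ae (g := fun _ => 1)]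
    · simp
    · filter_upwards [coeFn_oneLp (μ := μ)] with z hz
      simp [hz]
  exact (pow_eq_one_iff_of_nonneg (norm_nonneg _) two_ne_zero).mp h

theorem norm_mulUnitary_zpow_oneLp_sub [IsProbabilityMeasure μ] (n : ℤ) :
    ‖((mulUnitary μ ^ n : unitary (Lp ℂ 2 μ →L[ℂ] Lp ℂ 2 μ)) : Lp ℂ 2 μ →L[ℂ] Lp ℂ 2 μ) (oneLp μ)
      - oneLp μ‖ ^ 2 = 2 - 2 * (fourierCoefficient μ n).re := by
  rw [norm_sq_eq_integral, ← integral_norm_zpow_sub_one_sq]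
  refine integral_congr_ae ?_
  filter_upwards [coeFn_mulUnitary_zpow n (oneLp μ), coeFn_oneLp (μ := μ), Lp.coeFn_sub
    (((mulUnitary μ ^ n : unitary (Lp ℂ 2 μ →L[ℂ] Lp ℂ 2 μ)) : Lp ℂ 2 μ →L[ℂ] Lp ℂ 2 μ) (oneLp μ))
    (oneLp μ)] with z h1 h2 h3
  rw [h3, Pi.sub_apply, h1, h2, mul_one]

/-- A continuous probability measure with `δ ≤ Re μ̂` on `Q` yields a modified displacement of at
most `√(2 - 2 δ)`. -/
theorem exists_modifiedDisplacements_le {Q : Set ℤ} (hQ : Q.Nonempty) [IsProbabilityMeasure μ]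
    (hμ : IsContinuousMeasure μ) {δ : ℝ} (hδ : ∀ q ∈ Q, δ ≤ (fourierCoefficient μ q).re) :
    ∃ r ∈ modifiedDisplacements Q, r ≤ Real.sqrt (2 - 2 * δ) := by
  -- Needed to infer that `L²(μ)` is separable.
  have : Fact ((2 : ℝ≥0∞) ≠ ∞) := ⟨by simp⟩
  have hne : Nonempty Q := hQ.to_subtype
  refine ⟨displacement Q (mulUnitary μ) (oneLp μ), ⟨Lp ℂ 2 μ, inferInstance, inferInstance,
    inferInstance, inferInstance, mulUnitary μ, oneLp μ, not_hasSomeEigenvalue_mulUnitary hμ,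
    norm_oneLp, rfl⟩, ciSup_le fun q => Real.le_sqrt_of_sq_le ?_⟩
  rw [norm_mulUnitary_zpow_oneLp_sub]
  linarith [hδ q q.2]

end Multiplication

/-! ### Spectral measures by Fejér means -/

section Spectral

variable {H : Type*} [NormedAddCommGroup H] [InnerProductSpace ℂ H]

/-- Length of a diagonal of the `N × N` square; truncated subtraction covers `|n| ≥ N`. -/
theorem sum_ite_add_eq (N : ℕ) (n : ℤ) :
    ∑ j ∈ Finset.Ico (0 : ℤ) N, ∑ k ∈ Finset.Ico (0 : ℤ) N, (if n + j - k = 0 then (1 : ℂ) else 0)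
      = ((N - n.natAbs : ℕ) : ℂ) := by
  have h1 : ∀ j ∈ Finset.Ico (0 : ℤ) N,
      ∑ k ∈ Finset.Ico (0 : ℤ) N, (if n + j - k = 0 then (1 : ℂ) else 0)
        = if n + j ∈ Finset.Ico (0 : ℤ) N then 1 else 0 := by
    intro j _
    simp_rw [sub_eq_zero]
    rw [Finset.sum_ite_eq]
  rw [Finset.sum_congr rfl h1, Finset.sum_boole]
  congr 1
  have h2 : (Finset.Ico (0 : ℤ) N).filter (fun j => n + j ∈ Finset.Ico (0 : ℤ) N)
      = Finset.Ico (max 0 (-n)) (min N (N - n)) := by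
    ext j
    simp only [Finset.mem_filter, Finset.mem_Ico]
    omega
  rw [h2, Int.card_Ico]
  omega

theorem inner_zpow_zpow (e : H ≃ₗᵢ[ℂ] H) (x : H) (j k : ℤ) :
    inner ℂ ((e ^ j) x) ((e ^ k) x) = inner ℂ x ((e ^ (k - j)) x) := by
  rw [← (e ^ j).inner_map_map x]
  congr 1
  change (e ^ k) x = (e ^ j * e ^ (k - j)) x
  rw [← zpow_add, add_sub_cancel]

/-- The trigonometric polynomials `∑_{k < N} z⁻ᵏ eᵏ x`. -/
noncomputable def trigPolynomial (e : H ≃ₗᵢ[ℂ] H) (x : H) (N : ℕ) (z : Circle) : H :=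
  ∑ k ∈ Finset.Ico (0 : ℤ) N, (z : ℂ) ^ (-k) • (e ^ k) x

theorem continuous_trigPolynomial (e : H ≃ₗᵢ[ℂ] H) (x : H) (N : ℕ) :
    Continuous (trigPolynomial e x N) :=
  continuous_finsetSum _ fun k _ => (continuous_coe_zpow (-k)).smul continuous_const

theorem norm_sq_trigPolynomial (e : H ≃ₗᵢ[ℂ] H) (x : H) (N : ℕ) (z : Circle) :
    ((‖trigPolynomial e x N z‖ ^ 2 : ℝ) : ℂ) = ∑ j ∈ Finset.Ico (0 : ℤ) N,
      ∑ k ∈ Finset.Ico (0 : ℤ) N, (z : ℂ) ^ (j - k) * inner ℂ x ((e ^ (k - j)) x) := by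
  have h := inner_self_eq_norm_sq_to_K (𝕜 := ℂ) (trigPolynomial e x N z)
  rw [Complex.ofReal_pow]
  refine h.symm.trans ?_
  rw [trigPolynomial, sum_inner]
  refine Finset.sum_congr rfl fun j _ => ?_
  rw [inner_sum]
  refine Finset.sum_congr rfl fun k _ => ?_
  rw [inner_smul_left, inner_smul_right, inner_zpow_zpow, ← mul_assoc, map_zpow₀,
    ← Circle.coe_inv_eq_conj, Circle.coe_inv, inv_zpow', neg_neg, ← zpow_add₀ z.coe_ne_zero,
    ← sub_eq_add_neg]

theorem integral_zpow_mul_norm_sq_trigPolynomial (e : H ≃ₗᵢ[ℂ] H) (x : H) (N : ℕ) (n : ℤ) :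
    ∫ z : Circle, (z : ℂ) ^ n * ((‖trigPolynomial e x N z‖ ^ 2 : ℝ) : ℂ) ∂circleHaar
      = ((N - n.natAbs : ℕ) : ℂ) * inner ℂ x ((e ^ n) x) := by
  have h : ∀ z : Circle, (z : ℂ) ^ n * ((‖trigPolynomial e x N z‖ ^ 2 : ℝ) : ℂ)
      = ∑ j ∈ Finset.Ico (0 : ℤ) N, ∑ k ∈ Finset.Ico (0 : ℤ) N,
        (z : ℂ) ^ (n + j - k) * inner ℂ x ((e ^ (k - j)) x) := by
    intro z
    rw [norm_sq_trigPolynomial, Finset.mul_sum]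
    refine Finset.sum_congr rfl fun j _ => ?_
    rw [Finset.mul_sum]
    refine Finset.sum_congr rfl fun k _ => ?_
    rw [← mul_assoc, ← zpow_add₀ z.coe_ne_zero, add_sub_assoc]
  have hi : ∀ (m : ℤ) (c : ℂ), Integrable (fun z : Circle => (z : ℂ) ^ m * c) circleHaar :=
    fun m c => (integrable_coe_zpow _ m).mul_const c
  simp_rw [h]
  rw [integral_finsetSum _ fun j _ => integrable_finsetSum _ fun k _ => hi _ _,
    ← sum_ite_add_eq, Finset.sum_mul]
  refine Finset.sum_congr rfl fun j _ => ?_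
  rw [integral_finsetSum _ fun k _ => hi _ _, Finset.sum_mul]
  refine Finset.sum_congr rfl fun k _ => ?_
  rw [integral_mul_const, integral_zpow_circleHaar]
  split_ifs with hk
  · rw [show k - j = n by omega]
  · simp

/-- The Fejér mean is a squared norm divided by `N`, hence a nonnegative density for Haar measure;
its mass is the coefficient at `0`, namely `‖x‖² = 1`. -/
theorem fejer_mem_fourierTransforms (e : H ≃ₗᵢ[ℂ] H) {x : H} (hx : ‖x‖ = 1) {N : ℕ} (hN : 0 < N) :
    (fun n : ℤ => ((N - n.natAbs : ℕ) : ℂ) / N * inner ℂ x ((e ^ n) x)) ∈ fourierTransforms := by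
  have hN' : (N : ℂ) ≠ 0 := by exact_mod_cast hN.ne'
  let d : Circle → ℝ := fun z => ‖trigPolynomial e x N z‖ ^ 2 / N
  have hd : Continuous d := ((continuous_trigPolynomial e x N).norm.pow 2).div_const _
  have hd0 : ∀ z, 0 ≤ d z := fun z => by positivity
  have hint : ∀ n : ℤ, ∫ z : Circle, (z : ℂ) ^ n * (d z : ℂ) ∂circleHaar
      = ((N - n.natAbs : ℕ) : ℂ) / N * inner ℂ x ((e ^ n) x) := by
    intro n
    have := integral_zpow_mul_norm_sq_trigPolynomial e x N n
    rw [div_mul_eq_mul_div, ← this, ← integral_div]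
    refine integral_congr_ae (ae_of_all _ fun z => ?_)
    simp only [d]
    push_cast
    ring
  refine ⟨circleHaar.withDensity fun z => ENNReal.ofReal (d z), ⟨?_⟩, funext fun n => ?_⟩
  · rw [withDensity_apply _ MeasurableSet.univ, Measure.restrict_univ,
      ← ofReal_integral_eq_lintegral_ofReal (integrable_of_continuous hd) (ae_of_all _ hd0)]
    have h0 := hint 0
    simp only [zpow_zero, one_mul, Int.natAbs_zero, Nat.sub_zero, div_self hN'] at h0
    have h1 : inner ℂ x ((1 : H ≃ₗᵢ[ℂ] H) x) = (1 : ℂ) := by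
      rw [LinearIsometryEquiv.coe_one, id, inner_self_eq_norm_sq_to_K, hx]; simp
    rw [h1] at h0
    have h2 : ∫ z, d z ∂circleHaar = 1 := by
      have := integral_ofReal (μ := circleHaar) (𝕜 := ℂ) (f := d)
      have h3 := this.symm.trans h0
      exact Complex.ofReal_injective (h3.trans Complex.ofReal_one.symm)
    rw [h2, ENNReal.ofReal_one]
  · rw [fourierCoefficient, integral_withDensity_eq_integral_toReal_smul
      (by fun_prop) (ae_of_all _ fun z => ENNReal.ofReal_lt_top), ← hint n]
    refine integral_congr_ae (ae_of_all _ fun z => ?_)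
    simp only [ENNReal.toReal_ofReal (hd0 z), Complex.real_smul, mul_comm]

theorem tendsto_fejer (n : ℤ) :
    Tendsto (fun N : ℕ => ((N - n.natAbs : ℕ) : ℂ) / N) atTop (𝓝 1) := by
  have h : Tendsto (fun N : ℕ => (1 : ℂ) - n.natAbs / N) atTop (𝓝 (1 - 0)) :=
    (tendsto_const_div_atTop_nhds_zero_nat _).const_sub _
  rw [sub_zero] at h
  refine h.congr' ?_
  filter_upwards [eventually_ge_atTop n.natAbs, eventually_gt_atTop 0] with N hN hN0
  have : (N : ℂ) ≠ 0 := by exact_mod_cast hN0.ne'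
  rw [Nat.cast_sub hN, sub_div, div_self this]

/-- Herglotz's theorem for this sequence: it is the pointwise limit of Fejér transforms, and the set
of transforms is closed. -/
theorem inner_zpow_mem_fourierTransforms (e : H ≃ₗᵢ[ℂ] H) {x : H} (hx : ‖x‖ = 1) :
    (fun n : ℤ => inner ℂ x ((e ^ n) x)) ∈ fourierTransforms := by
  refine isCompact_fourierTransforms.isClosed.mem_of_tendsto (b := atTop)
    (f := fun (N : ℕ) (n : ℤ) => ((N - n.natAbs : ℕ) : ℂ) / N * inner ℂ x ((e ^ n) x))
    (tendsto_pi_nhds.mpr fun n => ?_) ?_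
  · simpa using (tendsto_fejer n).mul_const (inner ℂ x ((e ^ n) x))
  · filter_upwards [eventually_gt_atTop 0] with N hN
    exact fejer_mem_fourierTransforms e hx hN

variable [CompleteSpace H]

/-- The spectral measure of a unit vector under a unitary operator. -/
theorem exists_spectralMeasure (U : unitary (H →L[ℂ] H)) {x : H} (hx : ‖x‖ = 1) :
    ∃ μ : Measure Circle, IsProbabilityMeasure μ ∧ ∀ n : ℤ, fourierCoefficient μ n
      = inner ℂ x (((U ^ n : unitary (H →L[ℂ] H)) : H →L[ℂ] H) x) := by
  obtain ⟨μ, hμ, h⟩ := inner_zpow_mem_fourierTransforms (Unitary.linearIsometryEquiv U) hx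
  refine ⟨μ, hμ, fun n => ?_⟩
  rw [h]
  simp only [← map_zpow]
  rfl

theorem norm_zpow_sub_sq (U : unitary (H →L[ℂ] H)) {x : H} (hx : ‖x‖ = 1) (n : ℤ) :
    ‖((U ^ n : unitary (H →L[ℂ] H)) : H →L[ℂ] H) x - x‖ ^ 2
      = 2 - 2 * (inner ℂ x (((U ^ n : unitary (H →L[ℂ] H)) : H →L[ℂ] H) x)).re := by
  rw [norm_sub_sq (𝕜 := ℂ), Unitary.norm_map, hx, inner_re_symm]
  simp only [RCLike.re_to_complex]
  ring

theorem norm_zpow_sub_le_displacement (Q : Set ℤ) (U : unitary (H →L[ℂ] H)) (x : H) {q : ℤ}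
    (hq : q ∈ Q) :
    ‖((U ^ q : unitary (H →L[ℂ] H)) : H →L[ℂ] H) x - x‖ ≤ displacement Q U x := by
  refine le_ciSup (f := fun q : Q =>
    ‖((U ^ (q : ℤ) : unitary (H →L[ℂ] H)) : H →L[ℂ] H) x - x‖) ⟨‖x‖ + ‖x‖, ?_⟩ ⟨q, hq⟩
  rintro _ ⟨p, rfl⟩
  refine (norm_sub_le _ _).trans ?_
  rw [Unitary.norm_map]

/-! ### Atoms of spectral measures and eigenvectors -/

theorem tendsto_average_pow {ζ : ℂ} (hζ : ‖ζ‖ = 1) (h1 : ζ ≠ 1) :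
    Tendsto (fun N : ℕ => (N : ℂ)⁻¹ * ∑ k ∈ Finset.range N, ζ ^ k) atTop (𝓝 0) := by
  have hb : ∀ N : ℕ, ‖(N : ℂ)⁻¹ * ∑ k ∈ Finset.range N, ζ ^ k‖ ≤ (2 / ‖ζ - 1‖) / N := by
    intro N
    rw [geom_sum_eq h1, norm_mul, norm_inv, norm_div, Complex.norm_natCast, inv_mul_eq_div]
    gcongr
    refine (norm_sub_le _ _).trans ?_
    rw [norm_pow, hζ]
    norm_num
  exact squeeze_zero_norm hb (tendsto_const_div_atTop_nhds_zero_nat _)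

/-- The averages of `(w⁻¹z)ᵏ` are bounded by `1` and converge to the indicator of `{w}`; dominated
convergence applies. -/
theorem tendsto_average_fourierCoefficient (μ : Measure Circle) [IsProbabilityMeasure μ]
    (w : Circle) :
    Tendsto (fun N : ℕ => (N : ℂ)⁻¹ * ∑ k ∈ Finset.range N,
      ((w : ℂ)⁻¹) ^ k * fourierCoefficient μ k) atTop (𝓝 (μ.real {w} : ℂ)) := by
  have h : ∀ N : ℕ, (N : ℂ)⁻¹ * ∑ k ∈ Finset.range N, ((w : ℂ)⁻¹) ^ k * fourierCoefficient μ k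
      = ∫ z : Circle, (N : ℂ)⁻¹ * ∑ k ∈ Finset.range N, ((w : ℂ)⁻¹ * z) ^ k ∂μ := by
    intro N
    rw [integral_const_mul, integral_finsetSum]
    · congr 1
      refine Finset.sum_congr rfl fun k _ => ?_
      rw [fourierCoefficient, ← integral_const_mul]
      simp only [mul_pow, zpow_natCast]
    · intro k _
      exact integrable_of_continuous (by fun_prop)
  simp_rw [h]
  have hlim : ∫ z : Circle, ({w} : Set Circle).indicator (fun _ => (1 : ℂ)) z ∂μ
      = (μ.real {w} : ℂ) := by
    rw [integral_indicator_const _ (measurableSet_singleton w)]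
    simp
  rw [← hlim]
  have hz : ∀ z : Circle, ‖(w : ℂ)⁻¹ * z‖ = 1 := by
    intro z
    rw [norm_mul, norm_inv, Circle.norm_coe, Circle.norm_coe, inv_one, one_mul]
  refine tendsto_integral_of_dominated_convergence (fun _ => 1) (fun N => ?_)
    (integrable_const _) (fun N => ae_of_all _ fun z => ?_) (ae_of_all _ fun z => ?_)
  · exact Continuous.aestronglyMeasurable (by fun_prop)
  · rw [norm_mul, norm_inv, Complex.norm_natCast]
    rcases Nat.eq_zero_or_pos N with rfl | hN
    · simp
    rw [inv_mul_le_iff₀ (by exact_mod_cast hN), mul_one]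
    refine (norm_sum_le _ _).trans ?_
    simp only [norm_pow, hz, one_pow]
    simp
  · by_cases hzw : z = w
    · subst hzw
      rw [Set.indicator_of_mem (Set.mem_singleton z)]
      refine tendsto_const_nhds.congr' ?_
      filter_upwards [eventually_gt_atTop 0] with N hN
      have : (N : ℂ) ≠ 0 := by exact_mod_cast hN.ne'
      simp [this]
    · rw [Set.indicator_of_notMem (by simpa using hzw)]
      refine tendsto_average_pow (hz z) fun h => hzw ?_
      rw [inv_mul_eq_one₀ w.coe_ne_zero] at h
      exact (Circle.ext h).symm

/-- An atom of the spectral measure of a vector is an eigenvalue. -/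
theorem exists_eigenvector_of_spectralMeasure_singleton_ne_zero (U : unitary (H →L[ℂ] H)) {x : H}
    {μ : Measure Circle} [IsProbabilityMeasure μ]
    (hμ : ∀ n : ℤ, fourierCoefficient μ n
      = inner ℂ x (((U ^ n : unitary (H →L[ℂ] H)) : H →L[ℂ] H) x))
    {w : Circle} (hw : μ {w} ≠ 0) :
    ∃ y : H, y ≠ 0 ∧ (U : H →L[ℂ] H) y = (w : ℂ) • y := by
  -- The fixed vectors of this contraction are the solutions of `U y = w y`. By the mean ergodic
  -- theorem the averages of `fᵏ x` tend to the projection `y` of `x` on them, and `⟨x, y⟩ = μ{w} ≠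
  -- 0`.
  let f : H →L[ℂ] H := (w : ℂ)⁻¹ • (U : H →L[ℂ] H)
  have hfn : ‖f‖ ≤ 1 := by
    refine ContinuousLinearMap.opNorm_le_bound _ zero_le_one fun y => ?_
    simp only [f, _root_.smul_apply]
    rw [norm_smul, norm_inv, Circle.norm_coe, inv_one, Unitary.norm_map]
  have hiter : ∀ k : ℕ, f^[k] x
      = ((w : ℂ)⁻¹) ^ k • ((U ^ (k : ℤ) : unitary (H →L[ℂ] H)) : H →L[ℂ] H) x := by
    intro k
    induction k with
    | zero => simp
    | succ k ih =>
      have hU : U ^ ((k + 1 : ℕ) : ℤ) = U * U ^ (k : ℤ) := by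
        rw [Nat.cast_succ, add_comm, zpow_one_add]
      rw [Function.iterate_succ_apply', ih, map_smul, hU]
      simp only [f, _root_.smul_apply, smul_smul, pow_succ]
      rfl
  have hlim := f.tendsto_birkhoffAverage_orthogonalProjection (𝕜 := ℂ) hfn x
  set y : H := ((f.eqLocus (1 : H →L[ℂ] H)).orthogonalProjectionOnto x : H) with hy
  have hfy : f y = y := ((f.eqLocus (1 : H →L[ℂ] H)).orthogonalProjectionOnto x).2
  have h1 := ((continuous_const (y := x)).inner continuous_id (𝕜 := ℂ)).tendsto y |>.comp hlim
  have h2 := tendsto_average_fourierCoefficient μ w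
  have h3 : inner ℂ x y = (μ.real {w} : ℂ) := by
    refine tendsto_nhds_unique h1 (h2.congr fun N => ?_)
    simp only [Function.comp_apply, birkhoffAverage, birkhoffSum, id, inner_smul_right, inner_sum,
      hiter, hμ]
  refine ⟨y, fun h0 => ?_, ?_⟩
  · rw [h0, inner_zero_right] at h3
    have : μ.real {w} = 0 := by exact_mod_cast h3.symm
    exact hw ((measureReal_eq_zero_iff).mp this)
  · have : (w : ℂ) • f y = (U : H →L[ℂ] H) y := by
      simp only [f, _root_.smul_apply, smul_smul]
      rw [mul_inv_cancel₀ w.coe_ne_zero, one_smul]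
    rw [← this, hfy]

end Spectral

/-! ### The implications between the four assertions -/

theorem IsGenerating.nonempty {Q : Set ℤ} (hQ : IsGenerating Q) : Q.Nonempty := by
  rw [Set.nonempty_iff_ne_empty]
  rintro rfl
  rw [IsGenerating, AddSubgroup.closure_empty] at hQ
  exact bot_ne_top hQ

/-- A property of `Q`: every continuous probability measure has arbitrarily small coefficients
on `Q`. -/
def HasSmallCoefficients (Q : Set ℤ) : Prop :=
  ∀ μ : Measure Circle, IsProbabilityMeasure μ → IsContinuousMeasure μ →
    (⨅ n ∈ Q, ‖fourierCoefficient μ n‖ₑ) = 0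

theorem HasSmallCoefficients.exists_norm_lt {Q : Set ℤ} (h : HasSmallCoefficients Q)
    {μ : Measure Circle} [IsProbabilityMeasure μ] (hμ : IsContinuousMeasure μ) {δ : ℝ}
    (hδ : 0 < δ) : ∃ q ∈ Q, ‖fourierCoefficient μ q‖ < δ := by
  by_contra! hc
  have h1 : ENNReal.ofReal δ ≤ ⨅ n ∈ Q, ‖fourierCoefficient μ n‖ₑ := by
    refine le_iInf₂ fun q hq => ?_
    rw [← ofReal_norm]
    exact ENNReal.ofReal_le_ofReal (hc q hq)
  rw [h μ inferInstance hμ] at h1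
  exact absurd hδ (by simpa using h1)

/-- If no `ε` works, almost fixed vectors of operators without fixed vectors have spectral measures
with no mass at `1`, which feed the infinite convolution. -/
theorem HasSmallCoefficients.isKazhdanSet {Q : Set ℤ} (hQ : IsGenerating Q)
    (h : HasSmallCoefficients Q) : IsKazhdanSet Q := by
  by_contra hK
  obtain ⟨μ, hμp, hμc, hμ⟩ := exists_isContinuousMeasure_norm_sub_one_le hQ fun ε hε => by
    have hpair : ¬ IsKazhdanPair Q ε := fun hp => hK ⟨ε, hε, hp⟩
    rw [IsKazhdanPair] at hpair
    push Not at hpair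
    obtain ⟨H, _, _, _, _, U, ⟨x, hx, hd⟩, hU⟩ := hpair
    obtain ⟨σ, hσp, hσ⟩ := exists_spectralMeasure U hx
    refine ⟨σ, hσp, ?_, fun q hq => ?_⟩
    · by_contra h1
      obtain ⟨y, hy0, hy⟩ := exists_eigenvector_of_spectralMeasure_singleton_ne_zero U hσ h1
      exact hU ⟨y, hy0, by simpa using hy⟩
    · have h1 : (1 : ℂ) = inner ℂ x x := by rw [inner_self_eq_norm_sq_to_K, hx]; simp
      rw [hσ, h1, ← inner_sub_right]
      refine (norm_inner_le_norm _ _).trans ?_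
      rw [hx, one_mul]
      exact (norm_zpow_sub_le_displacement Q U x hq).trans hd.le
  obtain ⟨q, hq, hlt⟩ := h.exists_norm_lt hμc (δ := 1 / 2) (by norm_num)
  have h1 := norm_sub_norm_le (1 : ℂ) (fourierCoefficient μ q)
  rw [norm_sub_rev, norm_one] at h1
  linarith [hμ q hq]

theorem bddBelow_modifiedDisplacements (Q : Set ℤ) : BddBelow (modifiedDisplacements Q) := by
  refine ⟨0, ?_⟩
  rintro _ ⟨H, _, _, _, _, V, x, -, -, rfl⟩
  exact Real.iSup_nonneg fun _ => norm_nonneg _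

theorem exists_modifiedDisplacements_le_sqrt_two {Q : Set ℤ} (hQ : Q.Nonempty) :
    ∃ r ∈ modifiedDisplacements Q, r ≤ Real.sqrt 2 := by
  have h := exists_modifiedDisplacements_le hQ isContinuousMeasure_circleHaar (δ := 0)
    fun q _ => by
      rw [fourierCoefficient, integral_zpow_circleHaar]
      split_ifs <;> simp
  simpa using h

/-- Haar measure gives `≤`. For `≥`, the spectral measure of a vector is continuous when the
operator has no eigenvalue. -/
theorem HasSmallCoefficients.modifiedKazhdanConstant_eq {Q : Set ℤ} (hQ : Q.Nonempty)
    (h : HasSmallCoefficients Q) : modifiedKazhdanConstant Q = Real.sqrt 2 := by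
  obtain ⟨r₀, hr₀, hr₀le⟩ := exists_modifiedDisplacements_le_sqrt_two hQ
  refine le_antisymm ((csInf_le (bddBelow_modifiedDisplacements Q) hr₀).trans hr₀le)
    (le_csInf ⟨r₀, hr₀⟩ ?_)
  rintro _ ⟨H, _, _, _, _, V, x, hV, hx, rfl⟩
  by_contra! hlt
  obtain ⟨μ, hμp, hμ⟩ := exists_spectralMeasure V hx
  have hμc : IsContinuousMeasure μ := by
    intro w
    by_contra hw
    obtain ⟨y, hy0, hy⟩ := exists_eigenvector_of_spectralMeasure_singleton_ne_zero V hμ hw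
    exact hV ⟨w, y, hy0, hy⟩
  have hd0 : 0 ≤ displacement Q V x := Real.iSup_nonneg fun _ => norm_nonneg _
  have hd2 : displacement Q V x ^ 2 < 2 := (Real.lt_sqrt hd0).mp hlt
  -- A displacement `d` forces `Re μ̂(q) ≥ 1 - d²/2` on `Q`, which is positive when `d < √2`.
  obtain ⟨q, hq, hqlt⟩ := h.exists_norm_lt hμc
    (δ := 1 - displacement Q V x ^ 2 / 2) (by linarith)
  have h1 := norm_zpow_sub_sq V hx q
  rw [← hμ q] at h1
  have h2 := pow_le_pow_left₀ (norm_nonneg _) (norm_zpow_sub_le_displacement Q V x hq) 2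
  linarith [Complex.re_le_norm (fourierCoefficient μ q)]

/-- Passing to `normSqMeasure` turns a lower bound on `|μ̂|` into one on a real part, hence a
displacement below `√2`. -/
theorem hasSmallCoefficients_of_modifiedKazhdanConstant_eq {Q : Set ℤ} (hQ : Q.Nonempty)
    (h : modifiedKazhdanConstant Q = Real.sqrt 2) : HasSmallCoefficients Q := by
  intro μ hμp hμc
  by_contra hne
  obtain ⟨δ, hδ0, hδ⟩ := ENNReal.lt_iff_exists_nnreal_btwn.mp (pos_iff_ne_zero.mpr hne)
  have hδ0' : (0 : ℝ) < δ := by exact_mod_cast hδ0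
  have hle : ∀ q ∈ Q, (δ : ℝ) ≤ ‖fourierCoefficient μ q‖ := by
    intro q hq
    have h1 : (δ : ℝ≥0∞) ≤ ‖fourierCoefficient μ q‖ₑ := hδ.le.trans (iInf₂_le q hq)
    rw [enorm_eq_nnnorm] at h1
    exact_mod_cast h1
  obtain ⟨r, hr, hrle⟩ := exists_modifiedDisplacements_le hQ hμc.normSqMeasure
    (δ := (δ : ℝ) ^ 2) fun q hq => by
      rw [fourierCoefficient_normSqMeasure, Complex.ofReal_re]
      exact pow_le_pow_left₀ hδ0'.le (hle q hq) 2
  have h1 : Real.sqrt 2 ≤ r := h ▸ csInf_le (bddBelow_modifiedDisplacements Q) hr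
  have h2 : Real.sqrt (2 - 2 * (δ : ℝ) ^ 2) < Real.sqrt 2 :=
    (Real.sqrt_lt_sqrt_iff_of_pos (by norm_num)).mpr (by nlinarith)
  linarith

theorem eventually_absAtTopWithin {Q : Set ℤ} {p : ℤ → Prop} :
    (∀ᶠ n in absAtTopWithin Q, p n) ↔ ∃ N : ℕ, ∀ n ∈ Q, (N : ℤ) ≤ |n| → p n := by
  rw [absAtTopWithin, eventually_inf_principal, eventually_comap, eventually_atTop]
  constructor
  · rintro ⟨a, ha⟩
    exact ⟨a.toNat, fun n hn hN => ha |n| (by omega) n rfl hn⟩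
  · rintro ⟨N, hN⟩
    exact ⟨N, fun b hb n hn hq => hN n hq (hn ▸ hb)⟩

theorem HasSmallCoefficients.liminf_eq_zero {Q : Set ℤ} (h : HasSmallCoefficients Q)
    {μ : Measure Circle} [IsProbabilityMeasure μ] (hμ : IsContinuousMeasure μ) :
    liminf (fun n : ℤ => ‖fourierCoefficient μ n‖ₑ) (absAtTopWithin Q) = 0 := by
  by_contra hne
  obtain ⟨c, hc0, hc⟩ := ENNReal.lt_iff_exists_nnreal_btwn.mp (pos_iff_ne_zero.mpr hne)
  have hc0' : (0 : ℝ) < c := by exact_mod_cast hc0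
  obtain ⟨N, hN⟩ := eventually_absAtTopWithin.mp (eventually_lt_of_lt_liminf hc)
  obtain ⟨τ, hτp, hτc, hτ⟩ := exists_isContinuousMeasure_fourierCoefficient_ne_zero N
  obtain ⟨m, hm0, hm⟩ := Finset.exists_min_image (Finset.Icc (-(N : ℤ)) N)
    (fun n => ‖fourierCoefficient τ n‖ ^ 2) ⟨0, by simp⟩
  have hmpos : 0 < ‖fourierCoefficient τ m‖ ^ 2 := by
    have := hτ m (abs_le.mpr (Finset.mem_Icc.mp hm0))
    positivity
  -- On `Q` the averaged measure has coefficients at least this `δ`: `μ` provides it for `|q| ≥ N`,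
  -- `τ` for `|q| ≤ N`.
  obtain ⟨q, hq, hlt⟩ := h.exists_norm_lt (hμ.normSqMeasure.midMeasure hτc.normSqMeasure)
    (δ := min ((c : ℝ) ^ 2) (‖fourierCoefficient τ m‖ ^ 2) / 2) (by positivity)
  rw [fourierCoefficient_midMeasure, fourierCoefficient_normSqMeasure,
    fourierCoefficient_normSqMeasure, ← Complex.ofReal_add, norm_div, Complex.norm_real,
    Real.norm_of_nonneg (by positivity), RCLike.norm_ofNat] at hlt
  have ha := sq_nonneg ‖fourierCoefficient μ q‖
  have hb := sq_nonneg ‖fourierCoefficient τ q‖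
  rcases le_total (N : ℤ) |q| with hNq | hNq
  · have h1 := hN q hq hNq
    rw [enorm_eq_nnnorm] at h1
    have h2 : (c : ℝ) < ‖fourierCoefficient μ q‖ := by exact_mod_cast h1
    have h3 := pow_le_pow_left₀ hc0'.le h2.le 2
    linarith [min_le_left ((c : ℝ) ^ 2) (‖fourierCoefficient τ m‖ ^ 2)]
  · have h3 := hm q (Finset.mem_Icc.mpr (abs_le.mp hNq))
    linarith [min_le_right ((c : ℝ) ^ 2) (‖fourierCoefficient τ m‖ ^ 2)]

theorem exists_injective_tendsto_of_liminf_eq_zero {Q : Set ℤ} {φ : ℤ → ℂ}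
    (h : liminf (fun n : ℤ => ‖φ n‖ₑ) (absAtTopWithin Q) = 0) :
    ∃ n : ℕ → ℤ, Function.Injective n ∧ (∀ k, n k ∈ Q) ∧
      Tendsto (fun k => φ (n k)) atTop (𝓝 0) := by
  have hex : ∀ k N : ℕ, ∃ n ∈ Q, (N : ℤ) ≤ |n| ∧ ‖φ n‖ < 1 / ((k : ℝ) + 1) := by
    intro k N
    have hk : (0 : ℝ) < 1 / ((k : ℝ) + 1) := by positivity
    have hf : ∃ᶠ n in absAtTopWithin Q, ‖φ n‖ₑ < ENNReal.ofReal (1 / ((k : ℝ) + 1)) :=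
      frequently_lt_of_liminf_lt (by isBoundedDefault) (by rw [h]; exact ENNReal.ofReal_pos.mpr hk)
    by_contra! hc
    refine hf (eventually_absAtTopWithin.mpr ⟨N, fun n hn hN => ?_⟩)
    rw [not_lt, ← ofReal_norm]
    exact ENNReal.ofReal_le_ofReal (hc n hn hN)
  choose g hgQ hgN hgφ using hex
  -- The threshold `|m| + 1` makes the absolute values strictly increasing, hence the terms
  -- distinct.
  let n : ℕ → ℤ := fun k => Nat.rec (g 0 0) (fun j m => g (j + 1) (m.natAbs + 1)) k
  have hn : ∀ k, ∃ N, n k = g k N := by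
    rintro (_ | k)
    · exact ⟨0, rfl⟩
    · exact ⟨_, rfl⟩
  have hmono : StrictMono fun k => |n k| := strictMono_nat_of_lt_succ fun k => by
    have h1 := hgN (k + 1) ((n k).natAbs + 1)
    change |n k| < |g (k + 1) ((n k).natAbs + 1)|
    push_cast [Int.natCast_natAbs] at h1
    omega
  refine ⟨n, fun i j hij => hmono.injective (congrArg abs hij), fun k => ?_, ?_⟩
  · obtain ⟨N, hN⟩ := hn k
    exact hN ▸ hgQ k N
  · refine squeeze_zero_norm (fun k => ?_) tendsto_one_div_add_atTop_nhds_zero_nat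
    obtain ⟨N, hN⟩ := hn k
    exact hN ▸ (hgφ k N).le

theorem iInf_enorm_eq_zero_of_tendsto {Q : Set ℤ} {φ : ℤ → ℂ} {n : ℕ → ℤ} (hn : ∀ k, n k ∈ Q)
    (h : Tendsto (fun k => φ (n k)) atTop (𝓝 0)) : (⨅ q ∈ Q, ‖φ q‖ₑ) = 0 := by
  have h1 : Tendsto (fun k => ‖φ (n k)‖ₑ) atTop (𝓝 0) := by
    simpa [Function.comp_def] using (continuous_enorm.tendsto (0 : ℂ)).comp h
  exact le_antisymm (ge_of_tendsto' h1 fun k => iInf₂_le (n k) (hn k)) bot_le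

end KazhdanZ

/-- The infimum and the lower limit are taken in `[0, ∞]`, so the lower limit along a trivial
filter (`Q` finite) is `∞`, as usual for an infimum over the empty set. -/
theorem corollary5p2 (Q : Set ℤ) (hQ : KazhdanZ.IsGenerating Q) :
    List.TFAE [
      KazhdanZ.IsKazhdanSet Q ∧ KazhdanZ.modifiedKazhdanConstant Q = Real.sqrt 2,
      ∀ μ : Measure Circle, IsProbabilityMeasure μ → KazhdanZ.IsContinuousMeasure μ →
        (⨅ n ∈ Q, ‖KazhdanZ.fourierCoefficient μ n‖ₑ) = 0,
      ∀ μ : Measure Circle, IsProbabilityMeasure μ → KazhdanZ.IsContinuousMeasure μ →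
        liminf (fun n : ℤ => ‖KazhdanZ.fourierCoefficient μ n‖ₑ) (KazhdanZ.absAtTopWithin Q) = 0,
      ∀ μ : Measure Circle, IsProbabilityMeasure μ → KazhdanZ.IsContinuousMeasure μ →
        ∃ n : ℕ → ℤ, Function.Injective n ∧ (∀ k, n k ∈ Q) ∧
          Tendsto (fun k => KazhdanZ.fourierCoefficient μ (n k)) atTop (𝓝 0)] := by
  tfae_have 1 → 2 := fun h =>
    KazhdanZ.hasSmallCoefficients_of_modifiedKazhdanConstant_eq hQ.nonempty h.2
  tfae_have 2 → 1 := fun h =>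
    ⟨KazhdanZ.HasSmallCoefficients.isKazhdanSet hQ h,
      KazhdanZ.HasSmallCoefficients.modifiedKazhdanConstant_eq hQ.nonempty h⟩
  tfae_have 2 → 3 := fun h μ _ hμ => KazhdanZ.HasSmallCoefficients.liminf_eq_zero h hμ
  tfae_have 3 → 4 := fun h μ hp hμ =>
    KazhdanZ.exists_injective_tendsto_of_liminf_eq_zero (h μ hp hμ)
  tfae_have 4 → 2 := fun h μ hp hμ => by
    obtain ⟨n, -, hn, hlim⟩ := h μ hp hμ
    exact KazhdanZ.iInf_enorm_eq_zero_of_tendsto hn hlim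
  tfae_finish
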